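/- For each $n\in\mathbb N$ let $|X|=|Y|=n$ and let $f\colon X\times Y\to\{0,1\}$ be a random Boolean function with parameter $p=p(n)$, i.e. the values $f(x,y)$ are independent, each equal to $1$ with probability $p$ and to $0$ with probability $1-p$. Assume $p>\tfrac12$ (for all sufficiently large $n$) and put $\lambda=\lambda(n):=(1-p)\,n$. A 1-rectangle of $f$ is a product set $A\times B\subseteq X\times Y$ on which $f$ is identically $1$, and the cover number $C(f)$ is the smallest number of 1-rectangles whose union is $\{(x,y): f(x,y)=1\}$. A statement holds a.a.s. if its probability tends to $1$ as $n\to\infty$; $g\ll h$ means $g=o(h)$; and "a.a.s. $C(f)=O(g)$" means that there is a constant $K$, not depending on $n$, such that a.a.s. $C(f)\le K g(n)$. Then, a.a.s., $C(f)\ge(1-o(1))\,\lambda$ (that is, there is a sequence $\varepsilon_n\to0$ such that a.a.s. $C(f)\ge(1-\varepsilon_n)\lambda$), and: (a) if $\ln n\ll\lambda=O(n/\ln n)$, then a.a.s. $C(f)=O(\lambda\ln n)$; (b) if $\lambda=\Theta(\ln n)$, then a.a.s. $C(f)=O(\ln^2 n)$; (c) if $1\ll\lambda=o(\ln n)$,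 then a.a.s. $\displaystyle C(f)=O\Bigl(\max\Bigl(\lambda\ln n,\ \frac{\ln^2 n}{\ln((\ln n)/\lambda)}\Bigr)\Bigr)$. -/

import Mathlib

open Filter Topology MeasureTheory Asymptotics

namespace NondetCC

/-- The set of 1-entries of a Boolean function `f : X × Y → {0,1}`. -/
def oneEntries {X Y : Type*} (f : X × Y → Bool) : Set (X × Y) :=
  {z | f z = true}

/-- `R` is a 1-rectangle of `f`: a product `A × B` all of whose elements are 1-entries. -/
def IsOneRectangle {X Y : Type*} (f : X × Y → Bool) (R : Set (X × Y)) : Prop :=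
  ∃ (A : Set X) (B : Set Y), R = A ×ˢ B ∧ R ⊆ oneEntries f

/-- `C` is a 1-cover of `f`: a finite set of 1-rectangles whose union is the set of 1-entries. -/
def IsOneCover {X Y : Type*} (f : X × Y → Bool) (C : Finset (Set (X × Y))) : Prop :=
  (∀ R ∈ C, IsOneRectangle f R) ∧ (⋃ R ∈ C, R) = oneEntries f

/-- The cover number of `f`: the smallest size of a 1-cover
(one exists when `X` and `Y` are finite, see `exists_isOneCover`). -/
noncomputable def coverNumber {X Y : Type*} (f : X × Y → Bool) : ℕ :=
  sInf {k : ℕ | ∃ C : Finset (Set (X × Y)), IsOneCover f C ∧ C.card = k}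

theorem exists_isOneCover {X Y : Type*} [Finite X] [Finite Y] (f : X × Y → Bool) :
    ∃ C : Finset (Set (X × Y)), IsOneCover f C := by
  classical
  have hfin : ((fun z : X × Y => ({z} : Set (X × Y))) '' oneEntries f).Finite := Set.toFinite _
  refine ⟨hfin.toFinset, ?_, ?_⟩
  · intro R hR
    obtain ⟨z, hz, rfl⟩ := hfin.mem_toFinset.1 hR
    exact ⟨{z.1}, {z.2}, by simp, by simpa using hz⟩
  · ext ⟨x, y⟩
    simp

/-- The law of a random Boolean function `f : X × Y → {0,1}` with parameter `p`: the values
`f (x, y)` are independent, equal to 1 with probability `p` and to 0 with probability `1 - p`. -/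
noncomputable def randomFunction (X Y : Type*) [Fintype X] [Fintype Y] (p : unitInterval) :
    Measure (X × Y → Bool) :=
  Measure.pi fun _ : X × Y => ProbabilityTheory.bernoulliMeasure true false p

/-- The events `E n` hold asymptotically almost surely: their probabilities tend to 1. -/
def AAS {Ω : ℕ → Type*} [∀ n, MeasurableSpace (Ω n)] (μ : ∀ n, Measure (Ω n))
    (E : ∀ n, Set (Ω n)) : Prop :=
  Tendsto (fun n => μ n (E n)) atTop (𝓝 1)

end NondetCC

namespace NondetCC

/-! Lower bound, by counting: `k` rectangles determine `f`, so at most `2 ^ (2nk)` functions have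
cover number `≤ k` (`ncard_coverNumber_le`). A.a.s. `f` has at least `(1 - δ)λn` zeros, and each
such function has probability at most `2 ^ (-2(1 - δ)λn)`, since binary entropy lies above its chord
on `[0, 1/2]` (`measure_singleton_le`). With `k ≤ (1 - 2δ)λ` the union bound wins.

Upper bound: color the rows with `D` colors, `D` at least twice the number of zeros in any column.
Each color class times the columns without zeros in it is a 1-rectangle, and a random coloring
covers a given 1-entry with probability at least `1/2`. Halving the uncovered set `O(log n)` times
gives `C(f) = O(D log n)` (`coverNumber_le_mul`). A Chernoff bound over the columns controls `D`;
the three regimes differ only in its parameters `t` and `d`. -/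

/-! ### Covers as indexed families of rectangles -/

theorem coverNumber_le_card {X Y κ : Type*} [Fintype κ] {f : X × Y → Bool}
    (A : κ → Set X) (B : κ → Set Y) (h : ⋃ k, A k ×ˢ B k = oneEntries f) :
    coverNumber f ≤ Fintype.card κ := by
  classical
  suffices hC : IsOneCover f (Finset.univ.image fun k => A k ×ˢ B k) by
    have hmem : (Finset.univ.image fun k => A k ×ˢ B k).card ∈
        {k : ℕ | ∃ C : Finset (Set (X × Y)), IsOneCover f C ∧ C.card = k} := ⟨_, hC, rfl⟩
    exact (Nat.sInf_le hmem).trans Finset.card_image_le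
  refine ⟨?_, ?_⟩
  · intro R hR
    obtain ⟨k, -, rfl⟩ := Finset.mem_image.1 hR
    exact ⟨A k, B k, rfl, h ▸ Set.subset_iUnion (fun k => A k ×ˢ B k) k⟩
  · simpa using h

theorem exists_rectangles_of_coverNumber_le {X Y : Type*} [Finite X] [Finite Y]
    {f : X × Y → Bool} {k : ℕ} (h : coverNumber f ≤ k) :
    ∃ R : Fin k → Set X × Set Y, ⋃ i, (R i).1 ×ˢ (R i).2 = oneEntries f := by
  have hne : {k : ℕ | ∃ C : Finset (Set (X × Y)), IsOneCover f C ∧ C.card = k}.Nonempty := by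
    obtain ⟨C, hC⟩ := exists_isOneCover f
    exact ⟨_, C, hC, rfl⟩
  obtain ⟨C, ⟨hC, hU⟩, hcard⟩ := Nat.sInf_mem hne
  change C.card = coverNumber f at hcard
  choose A B hAB using fun R : C => hC R.1 R.2
  -- A smaller cover is padded with empty rectangles.
  refine ⟨fun i => if hi : (i : ℕ) < C.card then
    (A (C.equivFin.symm ⟨i, hi⟩), B (C.equivFin.symm ⟨i, hi⟩)) else (∅, ∅), ?_⟩
  rw [← hU]
  ext z
  simp only [Set.mem_iUnion]
  constructor
  · rintro ⟨i, hi⟩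
    split_ifs at hi with h1
    · refine ⟨_, (C.equivFin.symm ⟨i, h1⟩).2, ?_⟩
      rw [(hAB (C.equivFin.symm ⟨i, h1⟩)).1]
      exact hi
    · simp at hi
  · rintro ⟨R, hR, hz⟩
    have hlt := (C.equivFin ⟨R, hR⟩).2
    refine ⟨⟨C.equivFin ⟨R, hR⟩, by omega⟩, ?_⟩
    simp only [hlt, dif_pos, Fin.eta, Equiv.symm_apply_apply]
    rw [← (hAB ⟨R, hR⟩).1]
    exact hz

/-! ### Covering by row colorings -/

/-- Recoloring `x'` arbitrarily is injective on these colorings, because the old color of `x'` can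
be read off at `x`. So two rows collide with probability at most `1/D`. -/
theorem card_coloring_eq_mul_le {X : Type*} [Fintype X] [DecidableEq X] (D : ℕ) {x x' : X}
    (hx : x ≠ x') :
    (Finset.univ.filter fun c : X → Fin D => c x' = c x).card * D
      ≤ Fintype.card (X → Fin D) := by
  have hprod : (Finset.univ.filter fun c : X → Fin D => c x' = c x).card * D
      = ((Finset.univ.filter fun c : X → Fin D => c x' = c x) ×ˢ
        (Finset.univ : Finset (Fin D))).card := by
    rw [Finset.card_product, Finset.card_univ, Fintype.card_fin]
  rw [hprod, ← Finset.card_univ]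
  refine Finset.card_le_card_of_injOn (fun q => Function.update q.1 x' q.2) (by simp) ?_
  rintro ⟨c, i⟩ hc ⟨c', i'⟩ hc' h
  replace hc : c x' = c x := by simpa using hc
  replace hc' : c' x' = c' x := by simpa using hc'
  have hne : ∀ z, z ≠ x' → c z = c' z := fun z hz => by
    have := congrFun h z
    simpa [Function.update_of_ne hz] using this
  have hi : i = i' := by simpa using congrFun h x'
  refine Prod.ext (funext fun z => ?_) hi
  by_cases hz : z = x'
  · subst hz
    change c z = c' z
    rw [hc, hc', hne x hx]
  · exact hne z hz

/-- The coloring `c` of the rows covers `z` if no row with a zero in the column of `z` has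
the color of the row of `z`. -/
def Covers {X Y : Type*} {D : ℕ} (f : X × Y → Bool) (c : X → Fin D) (z : X × Y) : Prop :=
  ∀ x', f (x', z.2) = false → c x' ≠ c z.1

-- Union bound over the at most `D/2` zeros in the column of `z`, each colliding with probability at
-- most `1/D`.
open Classical in
theorem two_mul_card_not_covers_le {X Y : Type*} [Fintype X] {D : ℕ} (hD : 0 < D)
    {f : X × Y → Bool} {z : X × Y} (hz : f z = true)
    (hdeg : 2 * (Finset.univ.filter fun x => f (x, z.2) = false).card ≤ D) :
    2 * (Finset.univ.filter fun c : X → Fin D => ¬ Covers f c z).card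
      ≤ Fintype.card (X → Fin D) := by
  set S := Finset.univ.filter fun x => f (x, z.2) = false
  have hsub : (Finset.univ.filter fun c : X → Fin D => ¬ Covers f c z) ⊆
      S.biUnion fun x' => Finset.univ.filter fun c : X → Fin D => c x' = c z.1 := by
    intro c hc
    simpa [Covers, S] using hc
  have h1 := (Finset.card_le_card hsub).trans Finset.card_biUnion_le
  have h2 : (∑ x' ∈ S, (Finset.univ.filter fun c : X → Fin D => c x' = c z.1).card) * D
      ≤ S.card * Fintype.card (X → Fin D) := by
    rw [Finset.sum_mul, ← smul_eq_mul]
    refine Finset.sum_le_card_nsmul _ _ _ fun x' hx' => card_coloring_eq_mul_le D ?_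
    rintro rfl
    simp [S, hz] at hx'
  refine Nat.le_of_mul_le_mul_right ?_ hD
  calc _ ≤ 2 * ((∑ x' ∈ S, (Finset.univ.filter fun c : X → Fin D => c x' = c z.1).card) * D) := by
        rw [mul_assoc]; gcongr
    _ ≤ 2 * (S.card * Fintype.card (X → Fin D)) := by gcongr
    _ = (2 * S.card) * Fintype.card (X → Fin D) := by ring
    _ ≤ D * Fintype.card (X → Fin D) := by gcongr
    _ = _ := mul_comm _ _

-- Averaging: double counting the pairs of a coloring and an entry it misses.
open Classical in
theorem exists_coloring_halving {X Y : Type*} [Fintype X] {D : ℕ} (hD : 0 < D)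
    {f : X × Y → Bool}
    (hdeg : ∀ y, 2 * (Finset.univ.filter fun x => f (x, y) = false).card ≤ D)
    (U : Finset (X × Y)) (hU : ∀ z ∈ U, f z = true) :
    ∃ c : X → Fin D, 2 * (U.filter fun z => ¬ Covers f c z).card ≤ U.card := by
  have : NeZero D := ⟨hD.ne'⟩
  by_contra! h
  have h1 : ∑ _c : X → Fin D, U.card
      < ∑ c : X → Fin D, 2 * (U.filter fun z => ¬ Covers f c z).card :=
    Finset.sum_lt_sum_of_nonempty Finset.univ_nonempty fun c _ => h c
  have h2 : ∑ c : X → Fin D, (U.filter fun z => ¬ Covers f c z).card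
      = ∑ z ∈ U, (Finset.univ.filter fun c : X → Fin D => ¬ Covers f c z).card :=
    Finset.sum_card_bipartiteAbove_eq_sum_card_bipartiteBelow _
  rw [← Finset.mul_sum, h2, Finset.mul_sum, Finset.sum_const, smul_eq_mul, Finset.card_univ,
    mul_comm] at h1
  refine absurd h1 (not_lt.2 ?_)
  rw [← smul_eq_mul]
  exact Finset.sum_le_card_nsmul _ _ _ fun z hz =>
    two_mul_card_not_covers_le hD (hU z hz) (hdeg z.2)

theorem exists_covering_colorings {X Y : Type*} [Fintype X] {D : ℕ} (hD : 0 < D)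
    {f : X × Y → Bool}
    (hdeg : ∀ y, 2 * (Finset.univ.filter fun x => f (x, y) = false).card ≤ D)
    (k : ℕ) (U : Finset (X × Y)) (hU : ∀ z ∈ U, f z = true) (hk : U.card < 2 ^ k) :
    ∃ c : Fin k → X → Fin D, ∀ z ∈ U, ∃ j, Covers f (c j) z := by
  classical
  induction k generalizing U with
  | zero =>
    have : U = ∅ := by simpa using hk
    subst this
    exact ⟨finZeroElim, by simp⟩
  | succ k ih =>
    obtain ⟨c, hc⟩ := exists_coloring_halving hD hdeg U hU
    obtain ⟨c', hc'⟩ := ih (U.filter fun z => ¬ Covers f c z)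
      (fun z hz => hU z (Finset.mem_filter.1 hz).1) (by rw [pow_succ] at hk; omega)
    refine ⟨Fin.cons c c', fun z hz => ?_⟩
    by_cases h : Covers f c z
    · exact ⟨0, by simpa using h⟩
    · obtain ⟨j, hj⟩ := hc' z (Finset.mem_filter.2 ⟨hz, h⟩)
      exact ⟨j.succ, by simpa using hj⟩

theorem coverNumber_le_mul {X Y : Type*} [Fintype X] [Fintype Y] {D k : ℕ} (hD : 0 < D)
    {f : X × Y → Bool}
    (hdeg : ∀ y, 2 * (Finset.univ.filter fun x => f (x, y) = false).card ≤ D)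
    (hk : Fintype.card X * Fintype.card Y < 2 ^ k) :
    coverNumber f ≤ k * D := by
  classical
  obtain ⟨c, hc⟩ := exists_covering_colorings hD hdeg k
    (Finset.univ.filter fun z => f z = true) (by simp)
    ((Finset.card_le_univ _).trans_lt (by rwa [Fintype.card_prod]))
  have := coverNumber_le_card (f := f) (κ := Fin k × Fin D)
    (fun q => {x | c q.1 x = q.2}) (fun q => {y | ∀ x', f (x', y) = false → c q.1 x' ≠ q.2}) ?_
  · simpa using this
  ext ⟨x, y⟩
  simp only [Set.mem_iUnion, Set.mem_prod, Set.mem_ofPred_eq, oneEntries]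
  constructor
  · rintro ⟨q, hx, hy⟩
    by_contra h
    exact hy x (by simpa using h) hx
  · intro h
    obtain ⟨j, hj⟩ := hc (x, y) (by simpa using h)
    exact ⟨(j, c j x), rfl, hj⟩

/-! ### Functions of small cover number -/

theorem eq_false_of_coverNumber_eq_zero {X Y : Type*} [Finite X] [Finite Y]
    {f : X × Y → Bool} (h : coverNumber f = 0) : f = fun _ => false := by
  obtain ⟨R, hR⟩ := exists_rectangles_of_coverNumber_le h.le
  funext z
  by_contra hz
  have : z ∈ oneEntries f := by simpa [oneEntries] using hz
  simp [← hR] at this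

theorem ncard_coverNumber_le {X Y : Type*} [Fintype X] [Fintype Y] (k : ℕ) :
    {f : X × Y → Bool | coverNumber f ≤ k}.ncard
      ≤ 2 ^ ((Fintype.card X + Fintype.card Y) * k) := by
  classical
  have hsub : {f : X × Y → Bool | coverNumber f ≤ k} ⊆
      Set.range fun (R : Fin k → Set X × Set Y) (z : X × Y) =>
        decide (z ∈ ⋃ i, (R i).1 ×ˢ (R i).2) := by
    intro f hf
    obtain ⟨R, hR⟩ := exists_rectangles_of_coverNumber_le hf
    refine ⟨R, funext fun z => ?_⟩
    simp only [hR, oneEntries, Set.mem_ofPred_eq, Bool.decide_eq_true]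
  refine (Set.ncard_le_ncard hsub).trans ?_
  rw [← Set.image_univ]
  refine (Set.ncard_image_le).trans (le_of_eq ?_)
  rw [Set.ncard_univ, Nat.card_eq_fintype_card]
  simp [pow_mul, pow_add]

/-! ### Chernoff bounds and the probability of small cover number -/

section Probability

variable {X Y : Type*} [Fintype X] [Fintype Y]

instance (p : unitInterval) : IsProbabilityMeasure (randomFunction X Y p) := by
  unfold randomFunction; infer_instance

theorem integral_pow_card_zeros [DecidableEq (X × Y)] (p : unitInterval) (S : Finset (X × Y))
    (t : ℝ) :
    ∫ f, t ^ (S.filter fun z => f z = false).card ∂(randomFunction X Y p)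
      = (p + (1 - p) * t) ^ S.card := by
  have h : ∀ f : X × Y → Bool, t ^ (S.filter fun z => f z = false).card
      = ∏ z, (fun b : Bool => if z ∈ S then (if b = false then t else 1) else 1) (f z) := by
    intro f
    simp [Finset.prod_ite]
  simp_rw [h]
  rw [randomFunction, integral_fintype_prod_eq_prod
    (fun (z : X × Y) (b : Bool) => if z ∈ S then (if b = false then t else 1) else 1)]
  have h2 : ∀ z : X × Y, (∫ b : Bool, (if z ∈ S then (if b = false then t else 1) else 1)
      ∂(ProbabilityTheory.bernoulliMeasure true false p))
      = if z ∈ S then (p + (1 - p) * t : ℝ) else 1 := by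
    intro z
    split_ifs
    · simp [ProbabilityTheory.integral_bernoulliMeasure]
    · simp
  simp [h2]

/-- Markov's inequality for `t ^ Z`, `Z` the number of zeros in `S`; `t ≥ 1` yields upper tails and
`t ≤ 1` lower tails. -/
theorem mul_measure_le_pow_card_zeros_le (p : unitInterval) (S : Finset (X × Y))
    {t : ℝ} (ht : 0 ≤ t) (c : ℝ) :
    c * (randomFunction X Y p).real {f | c ≤ t ^ (S.filter fun z => f z = false).card}
      ≤ Real.exp ((1 - p) * (t - 1) * S.card) := by
  classical
  refine (mul_meas_ge_le_integral_of_nonneg (.of_forall fun f => by positivity)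
    Integrable.of_finite c).trans ?_
  rw [integral_pow_card_zeros, mul_comm _ (S.card : ℝ), Real.exp_nat_mul]
  have := p.2.1
  have := p.2.2
  refine pow_le_pow_left₀ (by nlinarith) ?_ _
  have := Real.add_one_le_exp ((1 - p : ℝ) * (t - 1))
  linarith

theorem measure_le_card_zeros_le (p : unitInterval) (S : Finset (X × Y)) {t : ℝ} (ht : 1 ≤ t)
    (m : ℕ) :
    (randomFunction X Y p).real {f | m ≤ (S.filter fun z => f z = false).card}
      ≤ Real.exp ((1 - p) * (t - 1) * S.card) / t ^ m := by
  rw [le_div_iff₀' (by positivity)]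
  refine le_trans ?_ (mul_measure_le_pow_card_zeros_le p S (zero_le_one.trans ht) (t ^ m))
  refine mul_le_mul_of_nonneg_left (measureReal_mono fun f hf => ?_) (by positivity)
  exact pow_le_pow_right₀ ht hf

theorem measure_card_zeros_lt_le (p : unitInterval) {δ : ℝ} (hδ : 0 ≤ δ) :
    (randomFunction X Y p).real {f | ((Finset.univ.filter fun z => f z = false).card : ℝ)
        < (1 - δ) * ((1 - p) * Fintype.card (X × Y))}
      ≤ Real.exp (-(δ ^ 2 / 4 * ((1 - p) * Fintype.card (X × Y)))) := by
  set N : ℝ := (1 - p) * Fintype.card (X × Y) with hN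
  have hp := p.2.2
  have hN0 : 0 ≤ N := by
    have : (0:ℝ) ≤ 1 - p := by linarith
    positivity
  have h := mul_measure_le_pow_card_zeros_le p (Finset.univ : Finset (X × Y))
    (Real.exp_nonneg (-(δ / 2))) (Real.exp (-(δ / 2) * ((1 - δ) * N)))
  rw [← le_div_iff₀' (Real.exp_pos _), ← Real.exp_sub] at h
  refine (measureReal_mono ?_).trans (h.trans (Real.exp_le_exp.2 ?_))
  · intro f hf
    simp only [Set.mem_ofPred_eq] at hf ⊢
    rw [← Real.exp_nat_mul, Real.exp_le_exp]
    nlinarith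
  -- With `s = δ/2`: `exp (-s) ≤ 1/(1 + s) ≤ 1 - s + s²`, the latter as `(1 + s)(1 - s + s²) = 1 +
  -- s³`.
  · have h1 : Real.exp (-(δ / 2)) ≤ 1 - δ / 2 + (δ / 2) ^ 2 := by
      rw [Real.exp_neg, inv_le_comm₀ (Real.exp_pos _) (by nlinarith [sq_nonneg (δ / 2 - 1)])]
      refine le_trans ?_ (Real.add_one_le_exp _)
      rw [inv_le_iff_one_le_mul₀ (by nlinarith [sq_nonneg (δ / 2 - 1)])]
      nlinarith [pow_nonneg hδ 3]
    rw [Finset.card_univ]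
    have h2 := mul_le_mul_of_nonneg_right h1 hN0
    have h3 : (1 - p : ℝ) * (Real.exp (-(δ / 2)) - 1) * Fintype.card (X × Y)
        = Real.exp (-(δ / 2)) * N - N := by rw [hN]; ring
    rw [h3]
    nlinarith

theorem measure_singleton_eq (p : unitInterval) (f : X × Y → Bool) :
    (randomFunction X Y p).real {f}
      = (1 - p : ℝ) ^ (Finset.univ.filter fun z => f z = false).card
        * (p : ℝ) ^ (Finset.univ.filter fun z => ¬ f z = false).card := by
  rw [measureReal_def, randomFunction, Measure.pi_singleton, ENNReal.toReal_prod]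
  have : ∀ z, (ProbabilityTheory.bernoulliMeasure true false p {f z}).toReal
      = if f z = false then (1 - p : ℝ) else p := by
    intro z
    rw [← measureReal_def]
    cases f z
    · rw [ProbabilityTheory.bernoulliMeasure_real_apply_of_notMem_of_mem] <;> simp
    · rw [ProbabilityTheory.bernoulliMeasure_real_apply_of_mem_of_notMem] <;> simp
  simp [this, Finset.prod_ite]

theorem two_mul_mul_log_two_le_binEntropy {q : ℝ} (h0 : 0 ≤ q) (h1 : q ≤ 1 / 2) :
    2 * q * Real.log 2 ≤ Real.binEntropy q := by
  have h := Real.strictConcave_binEntropy.concaveOn.2 (show (0 : ℝ) ∈ Set.Icc 0 1 by simp)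
    (show (2⁻¹ : ℝ) ∈ Set.Icc 0 1 by constructor <;> norm_num)
    (show 0 ≤ 1 - 2 * q by linarith) (show 0 ≤ 2 * q by linarith) (by ring)
  simp only [Real.binEntropy_two_inv, Real.binEntropy_zero, smul_eq_mul] at h
  rw [show (1 - 2 * q) * 0 + 2 * q * 2⁻¹ = q by ring] at h
  linarith

/-- As `1 - p < p`, the probability decreases in the number of zeros, so the fewest allowed zeros
are the worst case; there the exponent is at most `-(1 - δ)` times the entropy of `1 - p` per entry.
-/
theorem measure_singleton_le {p : unitInterval} (hp : (1 / 2 : ℝ) < p) (hp1 : (p : ℝ) < 1)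
    {δ : ℝ} (hδ : 0 ≤ δ) (hδ1 : δ ≤ 1) {f : X × Y → Bool}
    (hf : (1 - δ) * ((1 - p) * Fintype.card (X × Y))
      ≤ ((Finset.univ.filter fun z => f z = false).card : ℝ)) :
    (randomFunction X Y p).real {f}
      ≤ Real.exp (-(2 * (1 - δ) * ((1 - p) * Fintype.card (X × Y)) * Real.log 2)) := by
  rw [measure_singleton_eq]
  set Z := (Finset.univ.filter fun z => f z = false).card
  set W := (Finset.univ.filter fun z => ¬ f z = false).card
  have hZW : (Fintype.card (X × Y) : ℝ) = Z + W := by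
    have := Finset.card_filter_add_card_filter_not (s := (Finset.univ : Finset (X × Y)))
      (fun z => f z = false)
    rw [Finset.card_univ] at this
    exact_mod_cast this.symm
  set N : ℝ := ((Fintype.card (X × Y) : ℕ) : ℝ)
  have hN0 : 0 ≤ N := Nat.cast_nonneg _
  have hq : (0:ℝ) < 1 - p := by linarith
  have hp0 : (0:ℝ) < p := by linarith
  have hpow : (1 - p : ℝ) ^ Z * (p : ℝ) ^ W
      = Real.exp (Z * Real.log (1 - p : ℝ) + W * Real.log (p : ℝ)) := by
    rw [Real.exp_add, Real.exp_nat_mul, Real.exp_nat_mul, Real.exp_log hq, Real.exp_log hp0]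
  rw [hpow, Real.exp_le_exp]
  have hH := two_mul_mul_log_two_le_binEntropy (q := 1 - p) hq.le (by linarith)
  rw [Real.binEntropy, Real.log_inv, Real.log_inv, sub_sub_cancel] at hH
  set a := Real.log (1 - p : ℝ)
  set b := Real.log (p : ℝ)
  have hab : a ≤ b := Real.log_le_log hq (by linarith)
  have hb : b ≤ 0 := Real.log_nonpos hp0.le hp1.le
  have hW : (W : ℝ) = N - Z := by linarith
  rw [hW]
  have e1 := mul_le_mul_of_nonneg_right hf (sub_nonneg.2 hab)
  have e2 := mul_le_mul_of_nonneg_left hH (mul_nonneg (sub_nonneg.2 hδ1) hN0)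
  have e3 : 0 ≤ δ * N * -b := by have := neg_nonneg.2 hb; positivity
  nlinarith

theorem measure_le_ncard_mul (p : unitInterval) (S : Set (X × Y → Bool)) {c : ℝ}
    (h : ∀ f ∈ S, (randomFunction X Y p).real {f} ≤ c) :
    (randomFunction X Y p).real S ≤ S.ncard * c := by
  have h1 := sum_measureReal_singleton (μ := randomFunction X Y p) S.toFinite.toFinset
  rw [Set.Finite.coe_toFinset] at h1
  rw [← h1, Set.ncard_eq_toFinset_card S S.toFinite, ← nsmul_eq_mul]
  exact Finset.sum_le_card_nsmul _ _ _ fun f hf => h f (by simpa using hf)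

theorem measure_coverNumber_lt_le {n : ℕ} (hX : Fintype.card X = n) (hY : Fintype.card Y = n)
    {p : unitInterval} (hp : (1 / 2 : ℝ) < p) (hlam : 1 ≤ (1 - p : ℝ) * n)
    {δ : ℝ} (hδ : 0 ≤ δ) (hδ1 : δ ≤ 1) :
    (randomFunction X Y p).real {f | (coverNumber f : ℝ) < (1 - 2 * δ) * ((1 - p) * n)}
      ≤ 2 * Real.exp (-(δ ^ 2 / 4 * n)) := by
  have hp1 : (p : ℝ) < 1 := by
    by_contra h
    nlinarith [(Nat.cast_nonneg n : (0:ℝ) ≤ n)]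
  have hcard : (Fintype.card (X × Y) : ℝ) = n * n := by simp [hX, hY]
  set L : ℝ := (1 - p) * n with hL
  set k : ℕ := ⌊(1 - 2 * δ) * L⌋₊ with hk
  have hN : (1 - p : ℝ) * Fintype.card (X × Y) = L * n := by rw [hcard, hL]; ring
  have hn : (0:ℝ) ≤ n := Nat.cast_nonneg n
  have hnL : n ≤ L * n := by nlinarith
  have hzero := measure_card_zeros_lt_le (X := X) (Y := Y) p hδ
  rw [hN] at hzero
  set B : Set (X × Y → Bool) :=
    {f | ((Finset.univ.filter fun z => f z = false).card : ℝ) < (1 - δ) * (L * n)}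
  set S : Set (X × Y → Bool) := {f | (coverNumber f : ℝ) < (1 - 2 * δ) * L}
  have hSB : (randomFunction X Y p).real (S \ B) ≤ Real.exp (-(δ ^ 2 / 4 * n)) := by
    -- For a negative threshold the natural floor `k = 0` would exceed it.
    by_cases hneg : (1 - 2 * δ) * L < 0
    · have : S = ∅ := by
        ext f
        simp only [S, Set.mem_ofPred_eq, Set.mem_empty_iff_false, iff_false, not_lt]
        exact hneg.le.trans (Nat.cast_nonneg _)
      simp [this, Real.exp_nonneg]
    have hkL : (k : ℝ) ≤ (1 - 2 * δ) * L := Nat.floor_le (not_lt.1 hneg)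
    refine (measure_le_ncard_mul p _ fun f hf =>
      measure_singleton_le hp hp1 hδ hδ1 (hN ▸ not_lt.1 hf.2)).trans ?_
    have hcount : ((S \ B).ncard : ℝ) ≤ Real.exp (2 * n * k * Real.log 2) := by
      have h1 : (S \ B).ncard ≤ 2 ^ ((n + n) * k) := by
        have := ncard_coverNumber_le (X := X) (Y := Y) k
        rw [hX, hY] at this
        refine (Set.ncard_le_ncard fun f hf => ?_).trans this
        exact Nat.le_floor (le_of_lt hf.1)
      calc ((S \ B).ncard : ℝ) ≤ ((2 ^ ((n + n) * k) : ℕ) : ℝ) := by exact_mod_cast h1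
        _ = Real.exp (2 * n * k * Real.log 2) := by
          rw [show (2 * n * k : ℝ) = (((n + n) * k : ℕ) : ℝ) by push_cast; ring,
            Real.exp_nat_mul, Real.exp_log two_pos]
          push_cast; rfl
    refine (mul_le_mul_of_nonneg_right hcount (Real.exp_nonneg _)).trans ?_
    rw [← Real.exp_add, Real.exp_le_exp, hN]
    have hlog : 1 / 2 ≤ Real.log 2 := by linarith [Real.log_two_gt_d9]
    have e1 : 2 * n * k * Real.log 2 ≤ 2 * n * ((1 - 2 * δ) * L) * Real.log 2 := by gcongr
    have e2 : δ ^ 2 / 4 * n ≤ δ * (L * n) := by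
      have : δ ^ 2 / 4 ≤ δ := by nlinarith
      gcongr
    have e3 : δ * (L * n) ≤ 2 * (δ * (L * n)) * Real.log 2 := by
      have : 0 ≤ δ * (L * n) := by positivity
      nlinarith
    nlinarith
  calc (randomFunction X Y p).real S ≤ (randomFunction X Y p).real (B ∪ (S \ B)) :=
        measureReal_mono (by intro f hf; by_cases h : f ∈ B <;> simp [h, hf])
    _ ≤ _ := measureReal_union_le _ _
    _ ≤ Real.exp (-(δ ^ 2 / 4 * n)) + Real.exp (-(δ ^ 2 / 4 * n)) := by
        refine add_le_add (hzero.trans (Real.exp_le_exp.2 ?_)) hSB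
        have : 0 ≤ δ ^ 2 / 4 := by positivity
        nlinarith
    _ = _ := by ring

theorem measure_coverNumber_eq_zero_le {p : unitInterval} (hp : (1 / 2 : ℝ) < p) :
    (randomFunction X Y p).real {f | coverNumber f = 0}
      ≤ (1 / 2 : ℝ) ^ (Fintype.card X * Fintype.card Y) := by
  calc (randomFunction X Y p).real {f | coverNumber f = 0}
      ≤ (randomFunction X Y p).real {fun _ => false} :=
        measureReal_mono fun f hf => eq_false_of_coverNumber_eq_zero hf
    _ = (1 - p : ℝ) ^ (Fintype.card X * Fintype.card Y) := by
        simp [measure_singleton_eq]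
    _ ≤ _ := pow_le_pow_left₀ (by linarith [p.2.2]) (by linarith) _

/-- A union bound over the columns: with high probability no column has `m` zeros. -/
theorem measure_exists_column_le (p : unitInterval) {t : ℝ} (ht : 1 ≤ t) (m : ℕ) :
    (randomFunction X Y p).real
        {f | ∃ y, m ≤ (Finset.univ.filter fun x => f (x, y) = false).card}
      ≤ Fintype.card Y * (Real.exp ((1 - p) * t * Fintype.card X) / t ^ m) := by
  classical
  have hset : {f : X × Y → Bool | ∃ y, m ≤ (Finset.univ.filter fun x => f (x, y) = false).card}
      = ⋃ y ∈ (Finset.univ : Finset Y), {f | m ≤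
          (((Finset.univ : Finset X).image fun x => (x, y)).filter fun z => f z = false).card} := by
    ext f
    simp [Finset.filter_image, Finset.card_image_of_injective _ (Prod.mk_left_injective _)]
  rw [hset]
  refine (measureReal_biUnion_finset_le _ _).trans ?_
  rw [← Finset.card_univ, ← nsmul_eq_mul]
  refine Finset.sum_le_card_nsmul _ _ _ fun y _ => (measure_le_card_zeros_le p _ ht m).trans ?_
  rw [Finset.card_image_of_injective _ (Prod.mk_left_injective _), Finset.card_univ]
  have := p.2.2
  have : (0:ℝ) ≤ 1 - p := by linarith
  gcongr
  linarith

end Probability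

/-! ### Passage to asymptotic statements -/

theorem aas_of_measure_compl_le {X Y : ℕ → Type*} [∀ n, Fintype (X n)] [∀ n, Fintype (Y n)]
    {p : ℕ → unitInterval} {E : ∀ n, Set (X n × Y n → Bool)} {r : ℕ → ℝ}
    (hr : Tendsto r atTop (𝓝 0))
    (h : ∀ᶠ n in atTop, (randomFunction (X n) (Y n) (p n)).real (E n)ᶜ ≤ r n) :
    AAS (fun n => randomFunction (X n) (Y n) (p n)) E := by
  have hreal : Tendsto (fun n => (randomFunction (X n) (Y n) (p n)).real (E n)) atTop (𝓝 1) := by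
    refine tendsto_of_tendsto_of_tendsto_of_le_of_le' (g := fun n => 1 - r n)
      (by simpa using hr.const_sub 1) tendsto_const_nhds ?_ (.of_forall fun n => ?_)
    · filter_upwards [h] with n hn
      rw [probReal_compl_eq_one_sub (Set.toFinite _).measurableSet] at hn
      linarith
    · exact measureReal_le_one
  have := ENNReal.tendsto_ofReal hreal
  simpa [AAS, ofReal_measureReal] using this

theorem aas_coverNumber_ge {X Y : ℕ → Type*} [∀ n, Fintype (X n)] [∀ n, Fintype (Y n)]
    (hX : ∀ n, Fintype.card (X n) = n) (hY : ∀ n, Fintype.card (Y n) = n)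
    {p : ℕ → unitInterval} (hp : ∀ᶠ n in atTop, (1 / 2 : ℝ) < p n) :
    ∃ ε : ℕ → ℝ, Tendsto ε atTop (𝓝 0) ∧
      AAS (fun n => randomFunction (X n) (Y n) (p n))
        (fun n => {f | (1 - ε n) * ((1 - (p n : ℝ)) * n) ≤ (coverNumber f : ℝ)}) := by
  have hsqrt : Tendsto (fun n : ℕ => √(n : ℝ)) atTop atTop :=
    Real.tendsto_sqrt_atTop.comp tendsto_natCast_atTop_atTop
  have hsqrt2 : Tendsto (fun n : ℕ => √√(n : ℝ)) atTop atTop :=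
    Real.tendsto_sqrt_atTop.comp hsqrt
  -- `δ = n ^ (-1/4)` tends to 0 while `δ² n = √n` tends to infinity.
  refine ⟨fun n => 2 * (√√(n : ℝ))⁻¹, by simpa using hsqrt2.inv_tendsto_atTop.const_mul 2, ?_⟩
  refine aas_of_measure_compl_le
    (r := fun n : ℕ => 2 * Real.exp (-(√(n : ℝ) / 4)) + (1 / 2 : ℝ) ^ n) ?_ ?_
  · have h1 : Tendsto (fun n : ℕ => Real.exp (-(√(n : ℝ) / 4))) atTop (𝓝 0) :=
      Real.tendsto_exp_neg_atTop_nhds_zero.comp (hsqrt.atTop_div_const (by norm_num))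
    have h2 : Tendsto (fun n : ℕ => (1 / 2 : ℝ) ^ n) atTop (𝓝 0) :=
      tendsto_pow_atTop_nhds_zero_of_lt_one (by norm_num) (by norm_num)
    simpa using (h1.const_mul 2).add h2
  · filter_upwards [hp, eventually_ge_atTop 1] with n hpn hn
    have hn1 : (1 : ℝ) ≤ n := by exact_mod_cast hn
    have hcompl : {f : X n × Y n → Bool | (1 - 2 * (√√(n : ℝ))⁻¹) * ((1 - (p n : ℝ)) * n)
        ≤ (coverNumber f : ℝ)}ᶜ
        = {f | (coverNumber f : ℝ) < (1 - 2 * (√√(n : ℝ))⁻¹) * ((1 - (p n : ℝ)) * n)} := by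
      ext f; simp
    rw [hcompl]
    by_cases hl : 1 ≤ (1 - p n : ℝ) * n
    · have h1 : 1 ≤ √√(n : ℝ) := by simpa [Real.one_le_sqrt] using hn1
      have h := measure_coverNumber_lt_le (hX n) (hY n) hpn hl (δ := (√√(n : ℝ))⁻¹)
        (by positivity) (inv_le_one_of_one_le₀ h1)
      have h2 : (√√(n : ℝ))⁻¹ ^ 2 / 4 * n = √(n : ℝ) / 4 := by
        have hpos : 0 < √(n : ℝ) := Real.sqrt_pos.2 (by linarith)
        rw [inv_pow, Real.sq_sqrt hpos.le]
        field_simp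
        exact (Real.sq_sqrt (by linarith)).symm
      rw [h2] at h
      have : (0 : ℝ) ≤ (1 / 2) ^ n := by positivity
      linarith
    -- If `λ < 1` the claimed bound is below 1, so it fails only for cover number 0, that is, `f =
    -- 0`.
    · have h := measure_coverNumber_eq_zero_le (X := X n) (Y := Y n) hpn
      rw [hX, hY] at h
      have h1 : (1 / 2 : ℝ) ^ (n * n) ≤ (1 / 2) ^ n :=
        pow_le_pow_of_le_one (by norm_num) (by norm_num) (by nlinarith)
      have h2 : (0 : ℝ) ≤ 2 * Real.exp (-(√(n : ℝ) / 4)) := by positivity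
      refine (measureReal_mono fun f hf => ?_).trans (h.trans (h1.trans (by linarith)))
      have h3 : 0 ≤ (1 - p n : ℝ) * n := mul_nonneg (by linarith [(p n).2.2]) (by linarith)
      have h4 : 0 ≤ 2 * (√√(n : ℝ))⁻¹ := by positivity
      have h5 : (coverNumber f : ℝ) < 1 := by
        refine lt_of_lt_of_le hf ?_
        nlinarith
      have h6 : coverNumber f < 1 := by exact_mod_cast h5
      exact Nat.lt_one_iff.1 h6

theorem coverNumber_le_of_column_lt {X Y : Type*} [Fintype X] [Fintype Y] {n : ℕ}
    (hX : Fintype.card X = n) (hY : Fintype.card Y = n) (hn : 1 ≤ Real.log n)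
    {f : X × Y → Bool} {d : ℝ} (hd : 1 ≤ d)
    (hf : ∀ y, (Finset.univ.filter fun x => f (x, y) = false).card < ⌈d⌉₊) :
    (coverNumber f : ℝ) ≤ 20 * d * Real.log n := by
  have hm : (⌈d⌉₊ : ℝ) < d + 1 := Nat.ceil_lt_add_one (by linarith)
  have hm0 : 0 < ⌈d⌉₊ := Nat.ceil_pos.2 (by linarith)
  have hlt : n < 2 ^ (Nat.log 2 n + 1) := Nat.lt_pow_succ_log_self one_lt_two n
  -- The exponent is doubled because there are `n²` entries to cover.
  have h := coverNumber_le_mul (D := 2 * ⌈d⌉₊) (k := (Nat.log 2 n + 1) + (Nat.log 2 n + 1))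
    (by omega) (f := f) (fun y => by have := hf y; omega)
    (by rw [hX, hY, pow_add]; exact Nat.mul_lt_mul'' hlt hlt)
  have hk : ((Nat.log 2 n : ℕ) : ℝ) ≤ 3 / 2 * Real.log n := by
    have h1 := Real.natLog_le_logb n 2
    rw [Real.logb, Nat.cast_ofNat, le_div_iff₀ (Real.log_pos one_lt_two)] at h1
    have h2 := Real.log_two_gt_d9
    have h3 : (0 : ℝ) ≤ (Nat.log 2 n : ℕ) := Nat.cast_nonneg _
    nlinarith
  calc (coverNumber f : ℝ)
      ≤ ((((Nat.log 2 n + 1) + (Nat.log 2 n + 1)) * (2 * ⌈d⌉₊) : ℕ) : ℝ) := by exact_mod_cast h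
    _ = (2 * (Nat.log 2 n : ℕ) + 2) * (2 * ⌈d⌉₊) := by push_cast; ring
    _ ≤ (5 * Real.log n) * (2 * (2 * d)) := by
        gcongr <;> linarith
    _ = _ := by ring

/-- The exponential condition makes the column union bound `n · exp (λt) / t ^ d` at most `1/n`. -/
theorem aas_coverNumber_le {X Y : ℕ → Type*} [∀ n, Fintype (X n)] [∀ n, Fintype (Y n)]
    (hX : ∀ n, Fintype.card (X n) = n) (hY : ∀ n, Fintype.card (Y n) = n)
    {p : ℕ → unitInterval} {lam : ℕ → ℝ} (hlam : ∀ n, lam n = (1 - (p n : ℝ)) * n)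
    {d t g : ℕ → ℝ} (h : ∀ᶠ n in atTop, 1 ≤ t n ∧ 1 ≤ d n ∧
      Real.exp (lam n * t n + 2 * Real.log n) ≤ t n ^ d n ∧ 20 * d n * Real.log n ≤ g n) :
    AAS (fun n => randomFunction (X n) (Y n) (p n)) (fun n => {f | (coverNumber f : ℝ) ≤ g n}) := by
  refine aas_of_measure_compl_le (r := fun n : ℕ => (n : ℝ)⁻¹)
    tendsto_inv_atTop_nhds_zero_nat ?_
  filter_upwards [h, eventually_ge_atTop 1,
    (Real.tendsto_log_atTop.comp tendsto_natCast_atTop_atTop).eventually_ge_atTop 1]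
    with n ⟨ht, hd, hexp, hg⟩ hn hlog
  have hn0 : (0 : ℝ) < n := by exact_mod_cast hn
  refine (measureReal_mono fun f hf => ?_).trans
    ((measure_exists_column_le (X := X n) (Y := Y n) (p n) ht ⌈d n⌉₊).trans ?_)
  · by_contra hcon
    refine hf ((coverNumber_le_of_column_lt (hX n) (hY n) hlog hd fun y => ?_).trans hg)
    by_contra hy
    exact hcon ⟨y, not_lt.1 hy⟩
  · rw [hX, hY, show (1 - p n : ℝ) * t n * n = lam n * t n by rw [hlam]; ring]
    rw [Real.exp_add, show (2 : ℝ) * Real.log n = ((2 : ℕ) : ℝ) * Real.log n by norm_num,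
      Real.exp_nat_mul, Real.exp_log hn0] at hexp
    have hpow : t n ^ d n ≤ t n ^ ⌈d n⌉₊ := by
      rw [← Real.rpow_natCast]
      exact Real.rpow_le_rpow_of_exponent_le ht (Nat.le_ceil _)
    have htpos : 0 < t n ^ ⌈d n⌉₊ := by positivity
    rw [← mul_div_assoc, div_le_iff₀ htpos, inv_mul_eq_div, le_div_iff₀ hn0]
    linarith

end NondetCC

/-! ### The regimes of `λ` -/

theorem corollary2 {X Y : ℕ → Type*} [∀ n, Fintype (X n)] [∀ n, Fintype (Y n)]
    (hX : ∀ n, Fintype.card (X n) = n) (hY : ∀ n, Fintype.card (Y n) = n)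
    (p : ℕ → unitInterval) (hp : ∀ᶠ n in atTop, (1 / 2 : ℝ) < p n)
    (lam : ℕ → ℝ) (hlam : ∀ n, lam n = (1 - (p n : ℝ)) * n) :
    (∃ ε : ℕ → ℝ, Tendsto ε atTop (𝓝 0) ∧
      NondetCC.AAS (fun n => NondetCC.randomFunction (X n) (Y n) (p n))
        (fun n => {f | (1 - ε n) * lam n ≤ (NondetCC.coverNumber f : ℝ)})) ∧
    ((fun n : ℕ => Real.log n) =o[atTop] lam →
      lam =O[atTop] (fun n : ℕ => (n : ℝ) / Real.log n) →
      ∃ K : ℝ, NondetCC.AAS (fun n => NondetCC.randomFunction (X n) (Y n) (p n))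
        (fun n => {f | (NondetCC.coverNumber f : ℝ) ≤ K * (lam n * Real.log n)})) ∧
    (lam =Θ[atTop] (fun n : ℕ => Real.log n) →
      ∃ K : ℝ, NondetCC.AAS (fun n => NondetCC.randomFunction (X n) (Y n) (p n))
        (fun n => {f | (NondetCC.coverNumber f : ℝ) ≤ K * Real.log n ^ 2})) ∧
    ((fun _ : ℕ => (1 : ℝ)) =o[atTop] lam →
      lam =o[atTop] (fun n : ℕ => Real.log n) →
      ∃ K : ℝ, NondetCC.AAS (fun n => NondetCC.randomFunction (X n) (Y n) (p n))
        (fun n => {f | (NondetCC.coverNumber f : ℝ) ≤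
          K * max (lam n * Real.log n)
            (Real.log n ^ 2 / Real.log (Real.log n / lam n))})) := by
  have hlam0 : ∀ n, 0 ≤ lam n := fun n => by
    rw [hlam]
    exact mul_nonneg (by linarith [(p n).2.2]) (Nat.cast_nonneg n)
  have hlog : ∀ᶠ n : ℕ in atTop, 1 ≤ Real.log n :=
    (Real.tendsto_log_atTop.comp tendsto_natCast_atTop_atTop).eventually_ge_atTop 1
  have he : Real.exp 1 < 3 := by linarith [Real.exp_one_lt_d9]
  have he1 : 1 ≤ Real.exp 1 := Real.one_le_exp zero_le_one
  refine ⟨?_, fun h _ => ?_, fun h => ?_, fun h1 h => ?_⟩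
  · simp only [hlam]
    exact NondetCC.aas_coverNumber_ge hX hY hp
  -- Eventually `log n ≤ λ`, so `eλ + 2 log n ≤ 6λ`.
  · refine ⟨120, NondetCC.aas_coverNumber_le hX hY hlam (d := fun n => 6 * lam n)
      (t := fun _ => Real.exp 1) ?_⟩
    filter_upwards [hlog, h.bound one_pos] with n hn hb
    rw [one_mul, Real.norm_of_nonneg (zero_le_one.trans hn), Real.norm_of_nonneg (hlam0 n)] at hb
    refine ⟨he1, by linarith, ?_, le_of_eq (by ring)⟩
    rw [← Real.exp_mul, one_mul, Real.exp_le_exp]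
    nlinarith
  · obtain ⟨M, hM, hb⟩ := h.1.exists_pos
    refine ⟨20 * (3 * M + 2), NondetCC.aas_coverNumber_le hX hY hlam
      (d := fun n => (3 * M + 2) * Real.log n) (t := fun _ => Real.exp 1) ?_⟩
    filter_upwards [hlog, hb.bound] with n hn hb
    rw [Real.norm_of_nonneg (zero_le_one.trans hn), Real.norm_of_nonneg (hlam0 n)] at hb
    refine ⟨he1, by nlinarith, ?_, le_of_eq (by ring)⟩
    rw [← Real.exp_mul, one_mul, Real.exp_le_exp]
    nlinarith [hlam0 n]
  -- With `x = log n / λ` and `t = √x`, `d` is chosen so that `t ^ d = n³`; this suffices because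
  -- `λ√x ≤ λx = log n`.
  · refine ⟨120, NondetCC.aas_coverNumber_le hX hY hlam
      (d := fun n => 6 * Real.log n / Real.log (Real.log n / lam n))
      (t := fun n => √(Real.log n / lam n)) ?_⟩
    filter_upwards [hlog, h1.bound one_pos, h.bound (show (0 : ℝ) < 1 / 3 by norm_num)]
      with n hn hl hb
    rw [one_mul, norm_one, Real.norm_of_nonneg (hlam0 n)] at hl
    rw [Real.norm_of_nonneg (zero_le_one.trans hn), Real.norm_of_nonneg (hlam0 n)] at hb
    have hl0 : 0 < lam n := by linarith
    have hx : 3 ≤ Real.log n / lam n := by rw [le_div_iff₀ hl0]; linarith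
    have hxl : lam n * (Real.log n / lam n) = Real.log n := by field_simp
    have hxle : Real.log n / lam n ≤ Real.log n := div_le_self (by linarith) hl
    set x := Real.log n / lam n
    have hx0 : 0 < x := by linarith
    have hlogx : 1 ≤ Real.log x := by
      rw [Real.le_log_iff_exp_le hx0]; linarith
    have hlogx' : Real.log x ≤ x := Real.log_le_self hx0.le
    have hsx : √x ≤ x := (Real.sqrt_le_left hx0.le).2 (by nlinarith)
    refine ⟨Real.one_le_sqrt.2 (by linarith), ?_, ?_, ?_⟩
    · rw [le_div_iff₀ (by linarith)]
      linarith
    · rw [Real.rpow_def_of_pos (Real.sqrt_pos.2 hx0), Real.log_sqrt hx0.le, Real.exp_le_exp]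
      have e1 : Real.log x / 2 * (6 * Real.log n / Real.log x) = 3 * Real.log n := by
        field_simp; norm_num
      have e2 : lam n * √x ≤ lam n * x := by gcongr
      linarith
    · refine le_trans (le_of_eq ?_) (mul_le_mul_of_nonneg_left (le_max_right _ _) (by norm_num))
      ring
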